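/- All graphs are finite and may have multiple edges and loops (a loop contributes 2 to the valency of its vertex). A graph is eulerian if it is connected and all its vertices have even valency. A circuit is a connected 2-regular graph. A signed graph is a graph each of whose edges carries a sign $+1$ or $-1$. A circuit of a signed graph (that is, a subgraph which is a circuit) is unbalanced if the product of the signs of its edges is $-1$; a signed graph is balanced if it contains no unbalanced circuit, and unbalanced otherwise. A signed graph $G$ is tightly unbalanced if it is unbalanced and there is an edge $e$ of $G$ such that $G-e$ is balanced. Let $G$ be a signed eulerian graph with an odd number of negative edges. If any two unbalanced circuits of $G$ have an edge in common, then there exists an edge $e$ of $G$ which is contained in all unbalanced circuits of $G$. In particular, $G$ is tightly unbalanced. -/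

import Mathlib

open scoped Graph

namespace Graph

variable {α β : Type*}

/-- A multigraph (loops and parallel edges allowed) with finitely many vertices and edges. -/
structure IsFinite (G : Graph α β) : Prop where
  finite_vertexSet : V(G).Finite
  finite_edgeSet : E(G).Finite

/-- The valency of a vertex: the number of incident edges, each loop being counted twice.
It is used for finite graphs only. -/
noncomputable def valency (G : Graph α β) (v : α) : ℕ :=
  (G.incidenceSet v).ncard + (G.loopSet v).ncard

/-- A graph is connected if it has a vertex and any two vertices are joined by a walk. -/
def IsConnected (G : Graph α β) : Prop :=
  V(G).Nonempty ∧ ∀ u ∈ V(G), ∀ v ∈ V(G), Relation.ReflTransGen G.Adj u v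

/-- A graph is eulerian if it is finite and connected, with all vertices of even valency. -/
structure IsEulerian (G : Graph α β) : Prop where
  isFinite : G.IsFinite
  isConnected : G.IsConnected
  even_valency : ∀ v ∈ V(G), Even (G.valency v)

/-- A circuit is a finite connected 2-regular graph. In particular, a single loop and a pair of
parallel edges are circuits. -/
structure IsCircuit (C : Graph α β) : Prop where
  isFinite : C.IsFinite
  isConnected : C.IsConnected
  valency_eq_two : ∀ v ∈ V(C), C.valency v = 2

/-!
A signed graph is a graph `G` together with a signature, given by a function `σ : β → ℤˣ`
(where `ℤˣ = {1, -1}`) on the ambient type of edges. Only the values of `σ` on `E(G)` matter,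
and each subgraph of `G` inherits its signature from `σ`.
-/

/-- The set of negative edges of a signed graph. -/
def negativeEdges (G : Graph α β) (σ : β → ℤˣ) : Set β := {e ∈ E(G) | σ e = -1}

/-- The sign of a finite set of edges: the product of the signs of its elements. -/
noncomputable def edgeSign (σ : β → ℤˣ) (F : Set β) : ℤˣ := ∏ᶠ e ∈ F, σ e

/-- `C` is an unbalanced circuit of the signed graph `(G, σ)`: a subgraph of `G` that is
a circuit with sign `-1`. -/
structure IsUnbalancedCircuit (G : Graph α β) (σ : β → ℤˣ) (C : Graph α β) : Prop where
  le : C ≤ G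
  isCircuit : C.IsCircuit
  edgeSign_eq : edgeSign σ E(C) = -1

/-- A signed graph is balanced if it contains no unbalanced circuit. -/
def IsBalanced (G : Graph α β) (σ : β → ℤˣ) : Prop :=
  ∀ C : Graph α β, ¬ G.IsUnbalancedCircuit σ C

/-- A signed graph is tightly unbalanced if it is unbalanced, and deleting some one of its edges
leaves a balanced graph. -/
def IsTightlyUnbalanced (G : Graph α β) (σ : β → ℤˣ) : Prop :=
  ¬ G.IsBalanced σ ∧ ∃ e ∈ E(G), (G.deleteEdges {e}).IsBalanced σ

end Graph

namespace Graph

variable {α β : Type*}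

open Finset Function

/-- The coboundary of `x`, for edges with ends given by `s` and `t`. -/
def coboundary (s t : β → α) (x : α → ZMod 2) (b : β) : ZMod 2 := x (s b) + x (t b)

/-- A set of edges meeting every cut evenly. -/
def IsCycleSet (s t : β → α) (Z : Finset β) : Prop :=
  ∀ x : α → ZMod 2, ∑ b ∈ Z, coboundary s t x b = 0

lemma coboundary_add (s t : β → α) (x y : α → ZMod 2) (b : β) :
    coboundary s t (x + y) b = coboundary s t x b + coboundary s t y b := by
  simp only [coboundary, Pi.add_apply]; ring

lemma eq_one_of_ne_zero {a : ZMod 2} (h : a ≠ 0) : a = 1 := by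
  revert a; decide

lemma eq_zero_of_ne_one {a : ZMod 2} (h : a ≠ 1) : a = 0 := by
  revert a; decide

open Classical in
/-- A function that sums to zero over all cycle sets inside `F` is a coboundary on `F`. -/
lemma exists_coboundary_eq (s t : β → α) (F : Finset β) (τ : β → ZMod 2)
    (h : ∀ Z ⊆ F, IsCycleSet s t Z → ∑ b ∈ Z, τ b = 0) :
    ∃ x, ∀ b ∈ F, τ b = coboundary s t x b := by
  let D : (α → ZMod 2) →ₗ[ZMod 2] (F → ZMod 2) :=
    { toFun := fun x b ↦ coboundary s t x b
      map_add' := fun x y ↦ by ext b; exact coboundary_add s t x y b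
      map_smul' := fun c x ↦ by ext b; simp [coboundary, mul_add] }
  by_cases hτ : (fun b : F ↦ τ b) ∈ LinearMap.range D
  · obtain ⟨x, hx⟩ := hτ
    exact ⟨x, fun b hb ↦ (congrFun hx ⟨b, hb⟩).symm⟩
  obtain ⟨f, hf, hp⟩ := Submodule.exists_le_ker_of_notMem hτ
  let c : F → ZMod 2 := fun i ↦ f (fun j ↦ if i = j then 1 else 0)
  let Z : Finset β := (F.attach.filter (fun i ↦ c i ≠ 0)).map (Function.Embedding.subtype _)
  have key (k : β → ZMod 2) : ∑ b ∈ Z, k b = f (fun b : F ↦ k b) := by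
    rw [LinearMap.pi_apply_eq_sum_univ f, Finset.sum_map, Finset.sum_filter]
    refine Finset.sum_congr rfl fun i _ ↦ ?_
    change (if c i ≠ 0 then k i else 0) = k i * c i
    split_ifs with hi
    · rw [eq_one_of_ne_zero hi, mul_one]
    · simp [not_not.1 hi]
  refine absurd ?_ hf
  rw [← key]
  refine h Z (fun b hb ↦ ?_) fun x ↦ ?_
  · simp only [Z, Finset.mem_map] at hb
    obtain ⟨i, -, rfl⟩ := hb
    exact i.2
  · rw [key]
    exact hp ⟨x, rfl⟩

lemma IsCycleSet.even_card {s t : β → α} {F : Finset β} (hF : IsCycleSet s t F)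
    (x : α → ZMod 2) : Even (#{b ∈ F | coboundary s t x b ≠ 0}) := by
  rw [← ZMod.natCast_eq_zero_iff_even, ← Finset.sum_boole]
  refine Eq.trans ?_ (hF x)
  refine Finset.sum_congr rfl fun b _ ↦ ?_
  split_ifs with h
  · exact (eq_one_of_ne_zero h).symm
  · exact (not_not.1 h).symm

lemma IsCycleSet.sdiff [DecidableEq β] {s t : β → α} {F Z : Finset β} (hF : IsCycleSet s t F)
    (hZ : IsCycleSet s t Z) (h : Z ⊆ F) : IsCycleSet s t (F \ Z) := fun x ↦ by
  have := Finset.sum_sdiff (f := coboundary s t x) h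
  rwa [hZ x, hF x, add_zero] at this

lemma exists_coboundary_eq_add {s t : β → α} {v : α} {x₀ : α → ZMod 2}
    (hx₀ : ∀ u, u ≠ v → x₀ u = 0) {b : β} (hb : coboundary s t x₀ b ≠ 0) :
    ∃ u, ∀ x, coboundary s t x b = x u + x v := by
  by_cases hsb : s b = v
  · exact ⟨t b, fun x ↦ by rw [coboundary, hsb, add_comm]⟩
  by_cases htb : t b = v
  · exact ⟨s b, fun x ↦ by rw [coboundary, htb]⟩
  simp [coboundary, hx₀ _ hsb, hx₀ _ htb] at hb

/-- The edge set `F` with labels `σ` is an odd cycle set in which no two odd cycle sets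
are disjoint. -/
structure IsOddIntersecting (s t : β → α) (σ : β → ZMod 2) (F : Finset β) : Prop where
  isCycleSet : IsCycleSet s t F
  sum_eq_one : ∑ b ∈ F, σ b = 1
  not_disjoint : ∀ Z₁ ⊆ F, ∀ Z₂ ⊆ F, IsCycleSet s t Z₁ → IsCycleSet s t Z₂ →
    ∑ b ∈ Z₁, σ b = 1 → ∑ b ∈ Z₂, σ b = 1 → ¬ Disjoint Z₁ Z₂

variable [DecidableEq β]

/-- Up to switching, `A` is the set of edges of `F` with nonzero label. -/
def IsSignature (s t : β → α) (σ : β → ZMod 2) (F A : Finset β) : Prop :=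
  ∃ x, ∀ b ∈ F, σ b = coboundary s t x b + if b ∈ A then 1 else 0

/-- Replace the value at `e` by the sum of the values at `e` and `f`. -/
def merge (e f : β) (h : β → ZMod 2) : β → ZMod 2 := update h e (h e + h f)

/-- The set obtained from `Z` when `e` is expanded to the pair `e`, `f`. -/
def expand (e f : β) (Z : Finset β) : Finset β := if e ∈ Z then insert f Z else Z

lemma sum_expand {e f : β} {Z : Finset β} (hf : f ∉ Z) (h : β → ZMod 2) :
    ∑ b ∈ expand e f Z, h b = ∑ b ∈ Z, merge e f h b := by
  unfold expand merge
  split_ifs with he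
  · rw [Finset.sum_insert hf, Finset.sum_update_of_mem he, ← Finset.add_sum_erase _ _ he,
      Finset.sdiff_singleton_eq_erase]
    ring
  · exact Finset.sum_congr rfl fun b hb ↦ by rw [update_of_ne (ne_of_mem_of_not_mem hb he)]

lemma expand_subset {e f : β} {Z F : Finset β} (hf : f ∈ F) (h : Z ⊆ F.erase f) :
    expand e f Z ⊆ F := by
  unfold expand
  split_ifs with he
  · exact Finset.insert_subset hf (h.trans (Finset.erase_subset _ _))
  · exact h.trans (Finset.erase_subset _ _)

lemma disjoint_expand {e f : β} {Z₁ Z₂ : Finset β} (h₁ : f ∉ Z₁) (h₂ : f ∉ Z₂)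
    (h : Disjoint Z₁ Z₂) : Disjoint (expand e f Z₁) (expand e f Z₂) := by
  unfold expand
  split_ifs with he₁ he₂ he₂
  · exact absurd he₂ (Finset.disjoint_left.1 h he₁)
  · simpa [h₂] using h
  · simpa [h₁] using h
  · exact h

/-- The edge set obtained from `F` by replacing `e` and `f` by a single edge with the name `e`,
whose ends make its coboundaries the sums of those of `e` and `f`. -/
lemma IsOddIntersecting.merge {s t s' t' : β → α} {σ : β → ZMod 2} {F : Finset β} {e f : β}
    (h : IsOddIntersecting s t σ F) (he : e ∈ F) (hf : f ∈ F) (hef : e ≠ f)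
    (h₁ : ∀ x, ∃ x', ∀ b ∈ F.erase f, merge e f (coboundary s t x) b = coboundary s' t' x' b)
    (h₂ : ∀ x', ∃ x, ∀ b ∈ F.erase f, merge e f (coboundary s t x) b = coboundary s' t' x' b) :
    IsOddIntersecting s' t' (merge e f σ) (F.erase f) := by
  have hF : expand e f (F.erase f) = F := by
    simp [expand, hef, he, Finset.insert_erase hf]
  have hff : f ∉ F.erase f := Finset.notMem_erase f F
  have hcyc : ∀ Z ⊆ F.erase f, IsCycleSet s' t' Z → IsCycleSet s t (expand e f Z) := by
    intro Z hZF hZ x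
    obtain ⟨x', hx'⟩ := h₁ x
    rw [sum_expand (fun hfZ ↦ hff (hZF hfZ)), ← hZ x']
    exact Finset.sum_congr rfl fun b hb ↦ hx' b (hZF hb)
  refine ⟨fun x' ↦ ?_, ?_, fun Z₁ hZ₁ Z₂ hZ₂ hc₁ hc₂ ho₁ ho₂ hd ↦ ?_⟩
  · obtain ⟨x, hx⟩ := h₂ x'
    rw [← h.isCycleSet x, ← Finset.sum_congr rfl hx, ← sum_expand hff, hF]
  · rw [← sum_expand hff, hF, h.sum_eq_one]
  · have hf₁ : f ∉ Z₁ := fun hfZ ↦ hff (hZ₁ hfZ)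
    have hf₂ : f ∉ Z₂ := fun hfZ ↦ hff (hZ₂ hfZ)
    exact h.not_disjoint _ (expand_subset hf hZ₁) _ (expand_subset hf hZ₂) (hcyc _ hZ₁ hc₁)
      (hcyc _ hZ₂ hc₂) (by rw [sum_expand hf₁, ho₁]) (by rw [sum_expand hf₂, ho₂])
      (disjoint_expand hf₁ hf₂ hd)

/-- A singleton signature after merging `e` and `f` yields a signature with one or
three elements. -/
lemma IsSignature.of_merge {s t s' t' : β → α} {σ : β → ZMod 2} {F : Finset β} {e f g : β}
    (he : e ∈ F) (hf : f ∈ F) (hef : e ≠ f) (hg : g ∈ F.erase f)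
    (h₂ : ∀ x', ∃ x, ∀ b ∈ F.erase f, Graph.merge e f (coboundary s t x) b = coboundary s' t' x' b)
    (h : IsSignature s' t' (Graph.merge e f σ) (F.erase f) {g}) :
    (∃ g ∈ F, IsSignature s t σ F {g}) ∨
      ∃ g ∈ F, g ≠ e ∧ g ≠ f ∧ IsSignature s t σ F {e, f, g} := by
  obtain ⟨x', hx'⟩ := h
  obtain ⟨x, hx⟩ := h₂ x'
  have hgF : g ∈ F := Finset.mem_of_mem_erase hg
  have hgf : g ≠ f := Finset.ne_of_mem_erase hg
  have hb : ∀ b ∈ F, b ≠ e → b ≠ f → σ b = coboundary s t x b + if b = g then 1 else 0 := by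
    intro b hb hbe hbf
    have h1 := hx' b (by simp [hb, hbf])
    rw [← hx b (by simp [hb, hbf])] at h1
    simpa [Graph.merge, hbe] using h1
  have hee : σ e + σ f = coboundary s t x e + coboundary s t x f + if e = g then 1 else 0 := by
    have h1 := hx' e (by simp [he, hef])
    rw [← hx e (by simp [he, hef])] at h1
    simpa [Graph.merge] using h1
  have ext_sig (A : Finset β) (hA : ∀ b, b ≠ e → b ≠ f → (b ∈ A ↔ b = g))
      (hAe : σ e = coboundary s t x e + if e ∈ A then 1 else 0)
      (hAf : σ f = coboundary s t x f + if f ∈ A then 1 else 0) : IsSignature s t σ F A := by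
    refine ⟨x, fun b hbF ↦ ?_⟩
    by_cases hbe : b = e
    · rw [hbe, hAe]
    by_cases hbf : b = f
    · rw [hbf, hAf]
    rw [hb b hbF hbe hbf]
    simp only [hA b hbe hbf]
  by_cases heg : e = g
  · subst heg
    rw [if_pos rfl] at hee
    left
    obtain ⟨h1, h2⟩ | ⟨h1, h2⟩ := (by decide : ∀ a b c d : ZMod 2, a + b = c + d + 1 →
      (a = c ∧ b = d + 1) ∨ (a = c + 1 ∧ b = d)) _ _ _ _ hee
    · exact ⟨f, hf, ext_sig _ (by simp +contextual) (by simp [hef, h1]) (by simp [h2])⟩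
    · exact ⟨e, he, ext_sig _ (by simp) (by simp [h1]) (by simp [hef.symm, h2])⟩
  · rw [if_neg heg, add_zero] at hee
    obtain ⟨h1, h2⟩ | ⟨h1, h2⟩ := (by decide : ∀ a b c d : ZMod 2, a + b = c + d →
      (a = c ∧ b = d) ∨ (a = c + 1 ∧ b = d + 1)) _ _ _ _ hee
    · exact .inl ⟨g, hgF, ext_sig _ (by simp) (by simp [heg, h1]) (by simp [hgf.symm, h2])⟩
    · exact .inr ⟨g, hgF, Ne.symm heg, hgf,
        ext_sig _ (by simp +contextual) (by simp [h1]) (by simp [h2])⟩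

lemma IsSignature.exists_coboundary_eq {s t : β → α} {σ : β → ZMod 2} {F A B : Finset β}
    (hA : IsSignature s t σ F A) (hB : IsSignature s t σ F B) (v : α) :
    ∃ y : α → ZMod 2, y v = 0 ∧ ∀ b ∈ F, coboundary s t y b =
      (if b ∈ A then 1 else 0) + if b ∈ B then 1 else 0 := by
  obtain ⟨x, hx⟩ := hA
  obtain ⟨y, hy⟩ := hB
  refine ⟨fun a ↦ (x a + y a) + (x v + y v), CharTwo.add_self_eq_zero _, fun b hb ↦ ?_⟩
  have h := (hx b hb).symm.trans (hy b hb)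
  simp only [coboundary] at h ⊢
  exact (by decide : ∀ p q p' q' c i j : ZMod 2, p + q + i = p' + q' + j →
    p + p' + c + (q + q' + c) = i + j) _ _ _ _ _ _ _ h

lemma IsSignature.exists_filter_eq {s t : β → α} {σ : β → ZMod 2} {F A B : Finset β}
    (hA : IsSignature s t σ F A) (hB : IsSignature s t σ F B) (hAF : A ⊆ F) (hBF : B ⊆ F) :
    ∃ x, {b ∈ F | coboundary s t x b ≠ 0} = symmDiff A B := by
  rcases isEmpty_or_nonempty α with h | ⟨⟨v⟩⟩
  · have hF (C : Finset β) (hC : C ⊆ F) : C = ∅ :=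
      Finset.eq_empty_of_forall_notMem fun b _ ↦ h.elim (s b)
    exact ⟨0, by simp [hF F subset_rfl, hF A hAF, hF B hBF]⟩
  obtain ⟨y, -, hy⟩ := hA.exists_coboundary_eq hB v
  refine ⟨y, ?_⟩
  ext b
  rw [Finset.mem_filter, Finset.mem_symmDiff]
  by_cases hb : b ∈ F
  · rw [hy b hb]
    by_cases hbA : b ∈ A <;> by_cases hbB : b ∈ B <;> simp [hb, hbA, hbB]
    decide
  · have hbA : b ∉ A := fun h ↦ hb (hAF h)
    have hbB : b ∉ B := fun h ↦ hb (hBF h)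
    simp [hb, hbA, hbB]

lemma IsOddIntersecting.isSignature_of_loop {s t : β → α} {σ : β → ZMod 2} {F : Finset β}
    (h : IsOddIntersecting s t σ F) {e : β} (he : e ∈ F) (hst : s e = t e) (hσ : σ e = 1) :
    IsSignature s t σ F {e} := by
  have hcob (x : α → ZMod 2) : coboundary s t x e = 0 := by
    rw [coboundary, hst, CharTwo.add_self_eq_zero]
  obtain ⟨x, hx⟩ := exists_coboundary_eq s t (F.erase e) σ fun Z hZ hc ↦ by
    refine eq_zero_of_ne_one fun h1 ↦ h.not_disjoint Z (hZ.trans (Finset.erase_subset _ _)) {e}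
      (by simpa) hc (fun x ↦ by simp [hcob]) h1 (by simpa) ?_
    exact Finset.disjoint_singleton_right.2 fun heZ ↦ Finset.notMem_erase e F (hZ heZ)
  refine ⟨x, fun b hb ↦ ?_⟩
  by_cases hbe : b = e
  · simp [hbe, hσ, hcob]
  · simp [hbe, hx b (Finset.mem_erase.2 ⟨hbe, hb⟩)]

lemma IsOddIntersecting.erase {s t : β → α} {σ : β → ZMod 2} {F : Finset β}
    (h : IsOddIntersecting s t σ F) {e : β} (he : e ∈ F) (hst : s e = t e) (hσ : σ e = 0) :
    IsOddIntersecting s t σ (F.erase e) where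
  isCycleSet x := by
    rw [← h.isCycleSet x, ← Finset.add_sum_erase F _ he, coboundary, hst,
      CharTwo.add_self_eq_zero, zero_add]
  sum_eq_one := by rw [← h.sum_eq_one, ← Finset.add_sum_erase F _ he, hσ, zero_add]
  not_disjoint Z₁ hZ₁ Z₂ hZ₂ := h.not_disjoint Z₁ (hZ₁.trans (Finset.erase_subset _ _)) Z₂
    (hZ₂.trans (Finset.erase_subset _ _))

open Classical in
/-- Contraction of one edge of a cut of size two. -/
lemma exists_ends_of_cut {s t : β → α} {F : Finset β} {e f : β} (hef : e ≠ f) (hf : f ∈ F)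
    {y : α → ZMod 2} (hy : ∀ b ∈ F, coboundary s t y b = if b = e ∨ b = f then 1 else 0) :
    ∃ s' t' : β → α,
      (∀ x, ∃ x', ∀ b ∈ F.erase f, merge e f (coboundary s t x) b = coboundary s' t' x' b) ∧
      ∀ x', ∃ x, ∀ b ∈ F.erase f, merge e f (coboundary s t x) b = coboundary s' t' x' b := by
  let φ : α → α := fun a ↦ if a = s f then t f else a
  have hφs : φ (s f) = t f := if_pos rfl
  have hφt : φ (t f) = t f := by simp [φ]
  have hφ (x : α → ZMod 2) (hx : x (s f) = x (t f)) (a : α) : x (φ a) = x a := by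
    simp only [φ]; split_ifs with ha
    · rw [ha, hx]
    · rfl
  refine ⟨φ ∘ s, φ ∘ t, fun x ↦ ?_, fun x' ↦ ⟨x' ∘ φ, fun b _ ↦ ?_⟩⟩
  · by_cases hx : x (s f) = x (t f)
    · refine ⟨x, fun b _ ↦ ?_⟩
      have hxf : coboundary s t x f = 0 := by rw [coboundary, hx, CharTwo.add_self_eq_zero]
      have hb : coboundary (φ ∘ s) (φ ∘ t) x b = coboundary s t x b := by
        simp [coboundary, hφ x hx]
      by_cases hbe : b = e
      · subst hbe; simp [merge, hxf, hb]
      · simp [merge, hbe, hb]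
    · have hxf : coboundary s t x f = 1 :=
        eq_one_of_ne_zero fun h0 ↦ hx (CharTwo.add_eq_zero.1 h0)
      have hxy : (x + y) (s f) = (x + y) (t f) := by
        rw [← CharTwo.add_eq_zero]
        change coboundary s t (x + y) f = 0
        rw [coboundary_add, hxf, hy f hf, if_pos (.inr rfl)]
        decide
      refine ⟨x + y, fun b hb ↦ ?_⟩
      have hbf := Finset.ne_of_mem_erase hb
      have hbc : coboundary (φ ∘ s) (φ ∘ t) (x + y) b = coboundary s t x b + coboundary s t y b := by
        rw [← coboundary_add]
        simp only [coboundary, comp_apply, hφ _ hxy]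
      rw [hbc, hy b (Finset.mem_of_mem_erase hb)]
      by_cases hbe : b = e
      · subst hbe; simp [merge, hxf]
      · simp [merge, hbe, hbf]
  · have hxf : coboundary s t (x' ∘ φ) f = 0 := by
      simp [coboundary, hφs, hφt, CharTwo.add_self_eq_zero]
    by_cases hbe : b = e
    · subst hbe; simp only [merge, hxf, update_self, add_zero]; rfl
    · simp only [merge, update_of_ne hbe]; rfl

/-- Splitting off two edges at the vertex `v`. -/
lemma merge_coboundary_eq {s t : β → α} {e f : β} {u v w : α}
    (he : ∀ x, coboundary s t x e = x u + x v) (hf : ∀ x, coboundary s t x f = x w + x v)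
    (x : α → ZMod 2) (b : β) :
    merge e f (coboundary s t x) b = coboundary (update s e u) (update t e w) x b := by
  by_cases hbe : b = e
  · subst hbe
    simp only [merge, update_self, he, hf]
    simp only [coboundary, update_self]
    exact (by decide : ∀ p q r : ZMod 2, p + q + (r + q) = p + r) _ _ _
  · simp [merge, hbe, coboundary]

lemma mem_of_even_card {S : Finset β} (hS : Even #S) (hS₂ : #S ≠ 2) {b p q r : β} (hb : b ∈ S)
    (h : ∀ e ∈ S, e = b ∨ e = p ∨ e = q ∨ e = r) : p ∈ S := by
  by_contra hp
  have h1 : S ⊆ {b, q, r} := fun e he ↦ by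
    obtain rfl | rfl | rfl | rfl := h e he <;> first | exact absurd he hp | simp
  have h2 := (Finset.card_le_card h1).trans Finset.card_le_three
  have h3 := Finset.card_pos.2 ⟨b, hb⟩
  obtain ⟨k, hk⟩ := hS
  omega

/-- Suppose all cuts of an edge set have even size, different from two. Then the edges `a`, `b`,
`c`, `d` at a vertex do not have three signatures `{a, b, p}`, `{a, c, q}`, `{a, d, r}`,
apart from degenerate cases. -/
lemma false_of_signatures {s t : β → α} {σ : β → ZMod 2} {F : Finset β}
    (hF : IsCycleSet s t F) (hcut : ∀ x, #{b ∈ F | coboundary s t x b ≠ 0} ≠ 2)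
    {v u₁ u₂ u₃ : α} {a b c d p q r : β} (hb : b ∈ F) (hc : c ∈ F) (hd : d ∈ F)
    (hub : ∀ x, coboundary s t x b = x u₁ + x v) (huc : ∀ x, coboundary s t x c = x u₂ + x v)
    (hud : ∀ x, coboundary s t x d = x u₃ + x v)
    (hab : a ≠ b) (hac : a ≠ c) (had : a ≠ d) (hbc : b ≠ c) (hbd : b ≠ d) (hcd : c ≠ d)
    (hpF : p ≠ a ∧ p ≠ b ∧ p ≠ c ∧ p ≠ d) (hqF : q ≠ a ∧ q ≠ b ∧ q ≠ c ∧ q ≠ d)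
    (hrF : r ≠ a ∧ r ≠ b ∧ r ≠ c ∧ r ≠ d) (h₁ : IsSignature s t σ F {a, b, p})
    (h₂ : IsSignature s t σ F {a, c, q}) (h₃ : IsSignature s t σ F {a, d, r}) : False := by
  obtain ⟨y, hyv, hy⟩ := h₁.exists_coboundary_eq h₂ v
  obtain ⟨w, hwv, hw⟩ := h₁.exists_coboundary_eq h₃ v
  have hyb : y u₁ = 1 := by
    have := hy b hb; rw [hub, hyv] at this; simp at this; grind
  have hwb : w u₁ = 1 := by
    have := hw b hb; rw [hub, hwv] at this; simp at this; grind
  have hyc : y u₂ = 1 := by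
    have := hy c hc; rw [huc, hyv] at this; simp at this; grind
  have hwc : w u₂ = 0 := by
    have := hw c hc; rw [huc, hwv] at this; simp at this; grind
  have hyd : y u₃ = 0 := by
    have := hy d hd; rw [hud, hyv] at this; simp at this; grind
  have hwd : w u₃ = 1 := by
    have := hw d hd; rw [hud, hwv] at this; simp at this; grind
  have hsupp (e : β) (he : e ∈ F) (h : coboundary s t y e ≠ 0 ∨ coboundary s t w e ≠ 0) :
      e = b ∨ e = c ∨ e = d ∨ e = p ∨ e = q ∨ e = r := by
    rw [hy e he, hw e he] at h
    by_contra! hn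
    obtain ⟨n1, n2, n3, n4, n5, n6⟩ := hn
    simp only [Finset.mem_insert, Finset.mem_singleton, n1, n2, n3, n4, n5, n6, or_false,
      CharTwo.add_self_eq_zero, ne_eq, not_true] at h
  have region (m : ZMod 2 → ZMod 2 → ZMod 2) (z : α → ZMod 2) (hz : z = fun a ↦ m (y a) (w a))
      (e : β) (he : e ∈ F)
      (hez : coboundary s t z e ≠ 0)
      (hze : ∀ f ∈ F, f = b ∨ f = c ∨ f = d → coboundary s t z f ≠ 0 → f = e) :
      coboundary s t z p ≠ 0 := by
    have := mem_of_even_card (hF.even_card z) (hcut z) (b := e) (p := p) (q := q) (r := r)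
      (by simp [he, hez]) (fun f hf ↦ by
        obtain ⟨hfF, hf⟩ := Finset.mem_filter.1 hf
        have : coboundary s t y f ≠ 0 ∨ coboundary s t w f ≠ 0 := by
          by_contra! hn
          obtain ⟨hn1, hn2⟩ := hn
          rw [coboundary, CharTwo.add_eq_zero] at hn1 hn2
          exact hf (by rw [hz, coboundary, hn1, hn2, CharTwo.add_self_eq_zero])
        have h1 := hsupp f hfF this
        have h2 := hze f hfF
        tauto)
    exact (Finset.mem_filter.1 this).2
  have hB := region (fun i j ↦ i * j) _ rfl b hb (by simp [hub, hyb, hwb, hyv, hwv])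
    (by rintro f - (rfl | rfl | rfl) hf
        · rfl
        · simp [huc, hyc, hwc, hyv, hwv] at hf
        · simp [hud, hyd, hwd, hyv, hwv] at hf)
  have hC := region (fun i j ↦ i * (1 + j)) _ rfl c hc (by simp [huc, hyc, hwc, hyv, hwv])
    (by rintro f - (rfl | rfl | rfl) hf
        · simp [hub, hyb, hwb, hyv, hwv, CharTwo.add_self_eq_zero] at hf
        · rfl
        · simp [hud, hyd, hwd, hyv, hwv] at hf)
  have hD := region (fun i j ↦ (1 + i) * j) _ rfl d hd (by simp [hud, hyd, hwd, hyv, hwv])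
    (by rintro f - (rfl | rfl | rfl) hf
        · simp [hub, hyb, hwb, hyv, hwv, CharTwo.add_self_eq_zero] at hf
        · simp [huc, hyc, hwc, hyv, hwv] at hf
        · rfl)
  simp only [coboundary] at hB hC hD
  exact (by decide : ∀ i j i' j' : ZMod 2, i * j + i' * j' ≠ 0 → i * (1 + j) + i' * (1 + j') ≠ 0 →
    (1 + i) * j + (1 + i') * j' ≠ 0 → False) _ _ _ _ hB hC hD

/-- Suppose all cuts of an edge set have even size, different from two. Then it is not possible
that any two of four edges at a vertex extend to a signature with three elements. -/
lemma false_of_four_edges {s t : β → α} {σ : β → ZMod 2} {F : Finset β}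
    (hF : IsCycleSet s t F) (hcut : ∀ x, #{b ∈ F | coboundary s t x b ≠ 0} ≠ 2) {v : α}
    {S : Finset β} (hSF : S ⊆ F) (hS : 3 < #S)
    (hv : ∀ b ∈ S, ∃ u, ∀ x, coboundary s t x b = x u + x v)
    (hsig : ∀ e ∈ S, ∀ f ∈ S, e ≠ f → ∃ g ∈ F, g ≠ e ∧ g ≠ f ∧ IsSignature s t σ F {e, f, g}) :
    False := by
  have nondeg : ∀ a ∈ S, ∀ b ∈ S, ∀ c ∈ S, ∀ d ∈ S, a ≠ b → a ≠ c → a ≠ d → b ≠ c → b ≠ d → c ≠ d →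
      ¬ IsSignature s t σ F {a, b, c} → ¬ IsSignature s t σ F {a, b, d} →
      ¬ IsSignature s t σ F {a, c, d} → False := by
    intro a ha b hb c hc d hd hab hac had hbc hbd hcd h1 h2 h3
    obtain ⟨u₁, hu₁⟩ := hv b hb
    obtain ⟨u₂, hu₂⟩ := hv c hc
    obtain ⟨u₃, hu₃⟩ := hv d hd
    obtain ⟨p, -, hpa, hpb, hp⟩ := hsig a ha b hb hab
    obtain ⟨q, -, hqa, hqc, hq⟩ := hsig a ha c hc hac
    obtain ⟨r, -, hra, hrd, hr⟩ := hsig a ha d hd had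
    refine false_of_signatures hF hcut (hSF hb) (hSF hc) (hSF hd) hu₁ hu₂ hu₃ hab hac had hbc hbd
      hcd ⟨hpa, hpb, ?_, ?_⟩ ⟨hqa, ?_, hqc, ?_⟩ ⟨hra, ?_, ?_, hrd⟩ hp hq hr
    · rintro rfl; exact h1 hp
    · rintro rfl; exact h2 hp
    · rintro rfl; exact h1 (by rwa [Finset.pair_comm])
    · rintro rfl; exact h3 hq
    · rintro rfl; exact h2 (by rwa [Finset.pair_comm])
    · rintro rfl; exact h3 (by rwa [Finset.pair_comm])
  have excl : ∀ a ∈ S, ∀ b ∈ S, ∀ c ∈ S, ∀ d ∈ S, a ≠ c → a ≠ d → b ≠ c → b ≠ d → c ≠ d →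
      IsSignature s t σ F {a, b, c} → ¬ IsSignature s t σ F {a, b, d} := by
    intro a ha b hb c hc d hd hac had hbc hbd hcd h h'
    have hsub : ∀ e ∈ S, ({a, b, e} : Finset β) ⊆ F := fun e he ↦ by
      simp [Finset.insert_subset_iff, hSF ha, hSF hb, hSF he]
    obtain ⟨x, hx⟩ := h.exists_filter_eq h' (hsub c hc) (hsub d hd)
    refine hcut x ?_
    rw [hx, show symmDiff ({a, b, c} : Finset β) {a, b, d} = {c, d} by
      ext e; simp only [Finset.mem_symmDiff, Finset.mem_insert, Finset.mem_singleton]; grind]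
    exact Finset.card_pair hcd
  have deg : ∀ a ∈ S, ∀ b ∈ S, ∀ c ∈ S, ∀ d ∈ S, a ≠ b → a ≠ c → a ≠ d → b ≠ c → b ≠ d → c ≠ d →
      ¬ IsSignature s t σ F {a, b, c} := by
    intro a ha b hb c hc d hd hab hac had hbc hbd hcd h
    refine nondeg d hd a ha b hb c hc had.symm hbd.symm hcd.symm hab hac hbc
      (fun h' ↦ ?_) (fun h' ↦ ?_) (fun h' ↦ ?_)
    · exact excl a ha b hb c hc d hd hac had hbc hbd hcd h (by
        convert h' using 1; ext; simp; tauto)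
    · exact excl a ha c hc b hb d hd hab had hbc.symm hcd hbd
        (by rwa [Finset.pair_comm]) (by convert h' using 1; ext; simp; tauto)
    · exact excl b hb c hc a ha d hd hab.symm hbd hac.symm hcd had
        (by convert h using 1; ext; simp; tauto) (by convert h' using 1; ext; simp; tauto)
  obtain ⟨a, ha⟩ := Finset.card_pos.1 (by omega : 0 < #S)
  obtain ⟨b, hb, c, hc, d, hd, hbc, hbd, hcd⟩ := Finset.two_lt_card.1
    (by rw [Finset.card_erase_of_mem ha]; omega : 2 < #(S.erase a))
  rw [Finset.mem_erase] at hb hc hd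
  exact nondeg a ha b hb.2 c hc.2 d hd.2 hb.1.symm hc.1.symm hd.1.symm hbc hbd hcd
    (deg a ha b hb.2 c hc.2 d hd.2 hb.1.symm hc.1.symm hd.1.symm hbc hbd hcd)
    (deg a ha b hb.2 d hd.2 c hc.2 hb.1.symm hd.1.symm hc.1.symm hbd hbc hcd.symm)
    (deg a ha c hc.2 d hd.2 b hb.2 hc.1.symm hd.1.symm hb.1.symm hcd hbc.symm hbd.symm)

theorem IsOddIntersecting.exists_isSignature_singleton {s t : β → α} {σ : β → ZMod 2}
    {F : Finset β} (h : IsOddIntersecting s t σ F) : ∃ e ∈ F, IsSignature s t σ F {e} := by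
  induction hn : #F using Nat.strong_induction_on generalizing s t σ F with
  | _ n ih =>
  subst hn
  have ih' : ∀ {s t σ f}, f ∈ F → IsOddIntersecting s t σ (F.erase f) →
      ∃ e ∈ F.erase f, IsSignature s t σ (F.erase f) {e} :=
    fun hf h ↦ ih _ (Finset.card_erase_lt_of_mem hf) h rfl
  by_contra hno
  have hmerge {e f : β} (he : e ∈ F) (hf : f ∈ F) (hef : e ≠ f) {s' t' : β → α}
      (h₁ : ∀ x, ∃ x', ∀ b ∈ F.erase f, Graph.merge e f (coboundary s t x) b = coboundary s' t' x' b)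
      (h₂ : ∀ x', ∃ x, ∀ b ∈ F.erase f,
        Graph.merge e f (coboundary s t x) b = coboundary s' t' x' b) :
      ∃ g ∈ F, g ≠ e ∧ g ≠ f ∧ IsSignature s t σ F {e, f, g} := by
    obtain ⟨g, hg, hgs⟩ := ih' hf (h.merge he hf hef h₁ h₂)
    exact (hgs.of_merge he hf hef hg h₂).resolve_left hno
  have hloop : ∀ e ∈ F, s e ≠ t e := by
    intro e he hst
    by_cases hσ : σ e = 1
    · exact hno ⟨e, he, h.isSignature_of_loop he hst hσ⟩
    have hσ := eq_zero_of_ne_one hσ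
    obtain ⟨g, hg, x, hx⟩ := ih' he (h.erase he hst hσ)
    refine hno ⟨g, Finset.mem_of_mem_erase hg, x, fun b hb ↦ ?_⟩
    by_cases hbe : b = e
    · subst hbe
      rw [hσ, coboundary, hst, CharTwo.add_self_eq_zero, zero_add, if_neg]
      simpa [eq_comm] using Finset.ne_of_mem_erase hg
    · exact hx b (Finset.mem_erase.2 ⟨hbe, hb⟩)
  have hcut : ∀ x, #{b ∈ F | coboundary s t x b ≠ 0} ≠ 2 := by
    intro y hy
    obtain ⟨e, f, hef, hS⟩ := Finset.card_eq_two.1 hy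
    have hyb : ∀ b ∈ F, coboundary s t y b = if b = e ∨ b = f then 1 else 0 := by
      intro b hb
      have := congrArg (b ∈ ·) hS
      simp only [Finset.mem_filter, hb, true_and, Finset.mem_insert, Finset.mem_singleton,
        eq_iff_iff] at this
      rw [← if_congr this rfl rfl]
      split_ifs with h0
      · exact eq_one_of_ne_zero h0
      · exact not_not.1 h0
    have hsub : ({e, f} : Finset β) ⊆ F := hS ▸ Finset.filter_subset _ _
    have he : e ∈ F := hsub (by simp)
    have hf : f ∈ F := hsub (by simp)
    obtain ⟨s', t', h₁, h₂⟩ := exists_ends_of_cut hef hf hyb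
    obtain ⟨g, hg, hge, hgf, x, hx⟩ := hmerge he hf hef h₁ h₂
    refine hno ⟨g, hg, x + y, fun b hb ↦ ?_⟩
    rw [hx b hb, coboundary_add, hyb b hb]
    simp only [Finset.mem_insert, Finset.mem_singleton]
    by_cases hbe : b = e
    · simp [hbe, hge.symm]
    by_cases hbf : b = f
    · simp [hbf, hgf.symm]
    simp [hbe, hbf]
  obtain ⟨a, ha⟩ : F.Nonempty := by
    by_contra h0
    simpa [Finset.not_nonempty_iff_eq_empty.1 h0] using h.sum_eq_one
  obtain ⟨x₀, hx₀, hx₀'⟩ : ∃ x₀ : α → ZMod 2, x₀ (s a) = 1 ∧ ∀ u, u ≠ s a → x₀ u = 0 := by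
    classical
    exact ⟨Pi.single (s a) 1, by simp, fun u hu ↦ by simp [hu]⟩
  let S : Finset β := {b ∈ F | coboundary s t x₀ b ≠ 0}
  have hS : a ∈ S := Finset.mem_filter.2
    ⟨ha, by simp [coboundary, hx₀, hx₀' _ (hloop a ha).symm]⟩
  have hSe : Even #S := h.isCycleSet.even_card _
  have hS2 : #S ≠ 2 := hcut _
  have hS0 : 0 < #S := Finset.card_pos.2 ⟨a, hS⟩
  have hS3 : 3 < #S := by
    obtain ⟨k, hk⟩ := hSe
    omega
  have hv : ∀ b ∈ S, ∃ u, ∀ x, coboundary s t x b = x u + x (s a) := by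
    intro b hb
    exact exists_coboundary_eq_add hx₀' (Finset.mem_filter.1 hb).2
  refine false_of_four_edges (σ := σ) h.isCycleSet hcut (Finset.filter_subset _ _ : S ⊆ F) hS3 hv
    fun e he f hf hef ↦ ?_
  obtain ⟨u, hu⟩ := hv e he
  obtain ⟨w, hw⟩ := hv f hf
  exact hmerge (Finset.mem_filter.1 he).1 (Finset.mem_filter.1 hf).1 hef
    (fun x ↦ ⟨x, fun b _ ↦ merge_coboundary_eq hu hw x b⟩)
    (fun x ↦ ⟨x, fun b _ ↦ merge_coboundary_eq hu hw x b⟩)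

end Graph

namespace Graph

variable {α β : Type*}

open Finset Function

/-- A nonempty cycle set with no nonempty proper subset that is a cycle set. -/
structure IsMinCycleSet (s t : β → α) (Z : Finset β) : Prop where
  isCycleSet : IsCycleSet s t Z
  nonempty : Z.Nonempty
  eq_of_subset : ∀ Z' ⊆ Z, IsCycleSet s t Z' → Z'.Nonempty → Z' = Z

lemma exists_isMinCycleSet [DecidableEq β] {s t : β → α} {σ : β → ZMod 2} {Z : Finset β}
    (hZ : IsCycleSet s t Z) (hσ : ∑ b ∈ Z, σ b = 1) :
    ∃ Z₀ ⊆ Z, IsMinCycleSet s t Z₀ ∧ ∑ b ∈ Z₀, σ b = 1 := by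
  induction Z using Finset.strongInduction with
  | H Z ih =>
  by_cases hmin : ∀ Z' ⊆ Z, IsCycleSet s t Z' → Z'.Nonempty → Z' = Z
  · refine ⟨Z, subset_rfl, ⟨hZ, ?_, hmin⟩, hσ⟩
    by_contra h0
    simp [Finset.not_nonempty_iff_eq_empty.1 h0] at hσ
  push Not at hmin
  obtain ⟨Z', hsub, hc, hne, hneq⟩ := hmin
  by_cases hodd : ∑ b ∈ Z', σ b = 1
  · obtain ⟨Z₀, h₀, h⟩ := ih Z' (hsub.ssubset_of_ne hneq) hc hodd
    exact ⟨Z₀, h₀.trans hsub, h⟩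
  · have hsum := Finset.sum_sdiff (f := σ) hsub
    rw [eq_zero_of_ne_one hodd, add_zero, hσ] at hsum
    obtain ⟨Z₀, h₀, h⟩ := ih (Z \ Z') (Finset.sdiff_ssubset hsub hne) (hZ.sdiff hc hsub) hsum
    exact ⟨Z₀, h₀.trans Finset.sdiff_subset, h⟩

/-- Any two edges of a minimal cycle set form a cut of it. -/
lemma IsMinCycleSet.exists_coboundary_eq_pair [DecidableEq β] {s t : β → α} {Z : Finset β}
    (hZ : IsMinCycleSet s t Z) {e f : β} (he : e ∈ Z) (hf : f ∈ Z) (v : α) :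
    ∃ y : α → ZMod 2, y v = 0 ∧ ∀ b ∈ Z, coboundary s t y b =
      (if b = e then 1 else 0) + if b = f then 1 else 0 := by
  obtain ⟨x, hx⟩ := exists_coboundary_eq s t Z
    (fun b ↦ (if b = e then 1 else 0) + if b = f then 1 else 0) fun Z' hsub hc ↦ by
      rcases Z'.eq_empty_or_nonempty with rfl | hne
      · simp
      · rw [hZ.eq_of_subset Z' hsub hc hne, Finset.sum_add_distrib]
        simp only [Finset.sum_ite_eq', he, hf, if_true]
        decide
  refine ⟨fun a ↦ x a + x v, CharTwo.add_self_eq_zero _, fun b hb ↦ ?_⟩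
  rw [hx b hb]
  exact (by decide : ∀ p q c : ZMod 2, p + c + (q + c) = p + q) _ _ _

lemma IsMinCycleSet.card_le_two {s t : β → α} {Z : Finset β}
    (hZ : IsMinCycleSet s t Z) {v : α} {x₀ : α → ZMod 2} (hx₀ : ∀ u, u ≠ v → x₀ u = 0) :
    #{b ∈ Z | coboundary s t x₀ b ≠ 0} ≤ 2 := by
  classical
  by_contra! hcard
  obtain ⟨e, he, f, hf, g, hg, hef, heg, hfg⟩ := Finset.two_lt_card.1 hcard
  rw [Finset.mem_filter] at he hf hg
  obtain ⟨u₁, hu₁⟩ := exists_coboundary_eq_add hx₀ he.2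
  obtain ⟨u₂, hu₂⟩ := exists_coboundary_eq_add hx₀ hf.2
  obtain ⟨u₃, hu₃⟩ := exists_coboundary_eq_add hx₀ hg.2
  obtain ⟨y, hyv, hy⟩ := hZ.exists_coboundary_eq_pair he.1 hf.1 v
  obtain ⟨w, hwv, hw⟩ := hZ.exists_coboundary_eq_pair he.1 hg.1 v
  have hy₁ := hy e he.1
  have hy₃ := hy g hg.1
  have hw₁ := hw e he.1
  have hw₂ := hw f hf.1
  simp only [hu₁, hu₂, hu₃, hyv, hwv, hef, hef.symm, heg, heg.symm, hfg, hfg.symm, if_true,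
    if_false, add_zero] at hy₁ hy₃ hw₁ hw₂
  have hz : ∀ b ∈ Z, coboundary s t (y * w) b = if b = e then 1 else 0 := by
    intro b hb
    by_cases hbe : b = e
    · rw [hbe, hu₁]; simp [hy₁, hw₁, hyv]
    by_cases hbf : b = f
    · rw [hbf, hu₂]; simp [hw₂, hyv, hef.symm]
    by_cases hbg : b = g
    · rw [hbg, hu₃]; simp [hy₃, hyv, heg.symm]
    have h1 := hy b hb
    have h2 := hw b hb
    simp only [hbe, hbf, hbg, if_false, add_zero, coboundary, CharTwo.add_eq_zero] at h1 h2
    simp [coboundary, h1, h2, hbe, CharTwo.add_self_eq_zero]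
  have := hZ.isCycleSet (y * w)
  rw [Finset.sum_congr rfl hz] at this
  simp [he.1] at this

open Classical in
lemma valency_eq_sum {C : Graph α β} {s t : β → α} {Z : Finset β} (hE : E(C) = Z)
    (hst : ∀ b ∈ Z, C.IsLink b (s b) (t b)) (v : α) :
    C.valency v = ∑ b ∈ Z, ((if s b = v then 1 else 0) + if t b = v then 1 else 0) := by
  have h1 : C.incidenceSet v = ↑{b ∈ Z | s b = v ∨ t b = v} := by
    ext b
    rw [mem_incidenceSet, Finset.mem_coe, Finset.mem_filter]
    refine ⟨fun h ↦ ?_, ?_⟩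
    · have hb : b ∈ Z := by simpa [hE] using h.edge_mem
      exact ⟨hb, (h.eq_or_eq_of_isLink (hst b hb)).imp Eq.symm Eq.symm⟩
    · rintro ⟨hb, rfl | rfl⟩
      · exact (hst b hb).inc_left
      · exact (hst b hb).inc_right
  have h2 : C.loopSet v = ↑{b ∈ Z | s b = v ∧ t b = v} := by
    ext b
    rw [mem_loopSet, Finset.mem_coe, Finset.mem_filter]
    refine ⟨fun h ↦ ?_, ?_⟩
    · have hb : b ∈ Z := by simpa [hE] using h.edge_mem
      exact ⟨hb, (h.eq_of_inc (hst b hb).inc_left).symm, (h.eq_of_inc (hst b hb).inc_right).symm⟩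
    · rintro ⟨hb, h, h'⟩
      have := hst b hb
      rwa [h, h'] at this
  rw [valency, h1, h2, Set.ncard_coe_finset, Set.ncard_coe_finset, Finset.card_filter,
    Finset.card_filter, ← Finset.sum_add_distrib]
  refine Finset.sum_congr rfl fun b _ ↦ ?_
  by_cases hs : s b = v <;> by_cases ht : t b = v <;> simp [hs, ht]

lemma isCycleSet_of_even_valency {C : Graph α β} {s t : β → α} {Z : Finset β} (hE : E(C) = Z)
    (hV : V(C).Finite) (hst : ∀ b ∈ Z, C.IsLink b (s b) (t b))
    (h : ∀ v ∈ V(C), Even (C.valency v)) : IsCycleSet s t Z := by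
  classical
  intro x
  have hx : ∀ b ∈ Z, coboundary s t x b = ∑ v ∈ hV.toFinset,
      x v * ((if s b = v then 1 else 0) + if t b = v then 1 else 0) := by
    intro b hb
    simp [mul_add, Finset.sum_add_distrib, coboundary, (hst b hb).left_mem, (hst b hb).right_mem]
  rw [Finset.sum_congr rfl hx, Finset.sum_comm]
  refine Finset.sum_eq_zero fun v hv ↦ ?_
  have hv := h v (hV.mem_toFinset.1 hv)
  rw [valency_eq_sum hE hst, ← ZMod.natCast_eq_zero_iff_even] at hv
  push_cast at hv
  rw [← Finset.mul_sum, hv, mul_zero]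

/-- The subgraph formed by the edges in `Z` and their ends. -/
def edgeSubgraph (G : Graph α β) (Z : Set β) : Graph α β where
  vertexSet := {v | ∃ e ∈ Z, G.Inc e v}
  edgeSet := E(G) ∩ Z
  IsLink e x y := e ∈ Z ∧ G.IsLink e x y
  isLink_symm _ _ := ⟨fun _ _ h ↦ ⟨h.1, h.2.symm⟩⟩
  eq_or_eq_of_isLink_of_isLink _ _ _ _ _ h h' := h.2.left_eq_or_eq h'.2
  edge_mem_iff_exists_isLink e := ⟨fun h ↦ by simp [G.exists_isLink_of_mem_edgeSet h.1, h.2],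
    fun ⟨x, y, h⟩ ↦ ⟨h.2.edge_mem, h.1⟩⟩
  left_mem_of_isLink e _ _ h := ⟨e, h.1, h.2.inc_left⟩

lemma edgeSubgraph_le (G : Graph α β) (Z : Set β) : G.edgeSubgraph Z ≤ G where
  vertexSet_mono := fun _ ⟨_, _, h⟩ ↦ h.vertex_mem
  isLink_mono := fun _ _ _ h ↦ h.2

lemma IsMinCycleSet.isCircuit_edgeSubgraph {G : Graph α β} {s t : β → α} {Z : Finset β}
    (hZ : IsMinCycleSet s t Z) (hst : ∀ b ∈ Z, G.IsLink b (s b) (t b)) :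
    (G.edgeSubgraph Z).IsCircuit := by
  classical
  set C := G.edgeSubgraph Z with hC
  have hE : E(C) = Z := Set.inter_eq_right.2 fun b hb ↦ (hst b hb).edge_mem
  have hlink : ∀ b ∈ Z, C.IsLink b (s b) (t b) := fun b hb ↦ ⟨hb, hst b hb⟩
  have hV : ∀ v ∈ V(C), ∃ b ∈ Z, v = s b ∨ v = t b := fun v ⟨b, hb, hv⟩ ↦
    ⟨b, hb, hv.eq_or_eq_of_isLink (hst b hb)⟩
  refine ⟨⟨?_, hE ▸ Z.finite_toSet⟩, ⟨?_, fun u hu v hv ↦ ?_⟩, fun v hv ↦ ?_⟩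
  · refine (Z.image s ∪ Z.image t).finite_toSet.subset fun v hv ↦ ?_
    obtain ⟨b, hb, rfl | rfl⟩ := hV v hv
    · simp only [Finset.coe_union, Finset.coe_image]
      exact .inl ⟨b, hb, rfl⟩
    · simp only [Finset.coe_union, Finset.coe_image]
      exact .inr ⟨b, hb, rfl⟩
  · obtain ⟨b, hb⟩ := hZ.nonempty
    exact ⟨s b, (hlink b hb).left_mem⟩
  · let R : Set α := {w | Relation.ReflTransGen C.Adj u w}
    have hR : ∀ b ∈ Z, (s b ∈ R ↔ t b ∈ R) := fun b hb ↦
      ⟨fun h ↦ h.tail ⟨b, hlink b hb⟩, fun h ↦ h.tail ⟨b, (hlink b hb).symm⟩⟩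
    have hRV : ∀ w ∈ V(C), ∃ b ∈ Z, (s b ∈ R ↔ w ∈ R) := fun w hw ↦ by
      obtain ⟨b, hb, rfl | rfl⟩ := hV w hw
      · exact ⟨b, hb, Iff.rfl⟩
      · exact ⟨b, hb, hR b hb⟩
    have hcyc : IsCycleSet s t {b ∈ Z | s b ∈ R} := by
      intro x
      rw [← hZ.isCycleSet (fun a ↦ if a ∈ R then x a else 0), Finset.sum_filter]
      refine Finset.sum_congr rfl fun b hb ↦ ?_
      by_cases h : s b ∈ R
      · simp [coboundary, h, (hR b hb).1 h]
      · simp [coboundary, h, mt (hR b hb).2 h]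
    have heq := hZ.eq_of_subset _ (Finset.filter_subset _ _) hcyc (by
      obtain ⟨b, hb, h⟩ := hRV u hu
      exact ⟨b, Finset.mem_filter.2 ⟨hb, h.2 .refl⟩⟩)
    obtain ⟨b, hb, h⟩ := hRV v hv
    exact h.1 (Finset.filter_eq_self.1 heq b hb)
  · rw [valency_eq_sum hE hlink]
    by_cases hloop : ∃ e ∈ Z, s e = t e
    · obtain ⟨e, he, hse⟩ := hloop
      have hZe := hZ.eq_of_subset {e} (by simpa)
        (fun x ↦ by simp [coboundary, hse, CharTwo.add_self_eq_zero]) (by simp)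
      obtain ⟨b, hb, hbv⟩ := hV v hv
      rw [← hZe, Finset.mem_singleton] at hb
      subst hb
      have hv : v = s b := by rw [← hse, or_self] at hbv; exact hbv
      rw [← hZe, Finset.sum_singleton, ← hse, hv]
      simp
    push Not at hloop
    let x₀ : α → ZMod 2 := Pi.single v 1
    have hx₀ : ∀ u, u ≠ v → x₀ u = 0 := fun u hu ↦ by simp [x₀, hu]
    have hval : ∑ b ∈ Z, ((if s b = v then 1 else 0) + if t b = v then 1 else 0) =
        #{b ∈ Z | coboundary s t x₀ b ≠ 0} := by
      rw [Finset.card_filter]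
      refine Finset.sum_congr rfl fun b hb ↦ ?_
      have hne := hloop b hb
      by_cases hs : s b = v
      · have ht : t b ≠ v := fun h ↦ hne (hs.trans h.symm)
        simp [coboundary, x₀, hs, ht]
      · by_cases ht : t b = v <;> simp [coboundary, x₀, hs, ht]
    have hle := hZ.card_le_two hx₀
    obtain ⟨k, hk⟩ := hZ.isCycleSet.even_card x₀
    have hpos : 0 < ∑ b ∈ Z, ((if s b = v then 1 else 0) + if t b = v then 1 else 0) := by
      obtain ⟨b, hb, hbv⟩ := hV v hv
      refine Finset.sum_pos' (fun _ _ ↦ Nat.zero_le _) ⟨b, hb, ?_⟩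
      rcases hbv with rfl | rfl <;> simp
    omega

/-- The sign of an edge, written additively. -/
def parity (σ : β → ℤˣ) (b : β) : ZMod 2 := if σ b = -1 then 1 else 0

lemma edgeSign_eq_neg_one_iff (σ : β → ℤˣ) (Z : Finset β) :
    edgeSign σ (Z : Set β) = -1 ↔ ∑ b ∈ Z, parity σ b = 1 := by
  classical
  rw [edgeSign, finprod_mem_coe_finset]
  have h : ∏ b ∈ Z, σ b = if ∑ b ∈ Z, parity σ b = 1 then -1 else 1 := by
    induction Z using Finset.induction_on with
    | empty => simp
    | insert b Z hb ih =>
      rw [Finset.prod_insert hb, Finset.sum_insert hb, ih, parity]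
      generalize ∑ b ∈ Z, parity σ b = p
      generalize σ b = q
      revert p q
      decide
  rw [h]
  split_ifs with h1 <;> simp [h1]

end Graph

theorem mainTheorem8 {α β : Type*} (G : Graph α β) (σ : β → ℤˣ)
    (hG : G.IsEulerian)
    (hodd : Odd (G.negativeEdges σ).ncard)
    (hmeet : ∀ C₁ C₂ : Graph α β, G.IsUnbalancedCircuit σ C₁ → G.IsUnbalancedCircuit σ C₂ →
      (E(C₁) ∩ E(C₂)).Nonempty) :
    (∃ e ∈ E(G), ∀ C : Graph α β, G.IsUnbalancedCircuit σ C → e ∈ E(C)) ∧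
      G.IsTightlyUnbalanced σ := by
  classical
  obtain ⟨F, hF⟩ := hG.isFinite.finite_edgeSet.exists_finset_coe
  have hmemF {b : β} : b ∈ F ↔ b ∈ E(G) := by rw [← hF, Finset.mem_coe]
  obtain ⟨s, t, hst⟩ : ∃ s t : β → α, ∀ b ∈ F, G.IsLink b (s b) (t b) := by
    obtain ⟨v, -⟩ := hG.isConnected.1
    have h (b : β) : ∃ x y, b ∈ F → G.IsLink b x y := by
      by_cases hb : b ∈ F
      · obtain ⟨x, y, hxy⟩ := Graph.exists_isLink_of_mem_edgeSet (hmemF.1 hb)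
        exact ⟨x, y, fun _ ↦ hxy⟩
      · exact ⟨v, v, fun hb' ↦ absurd hb' hb⟩
    choose s t hst using h
    exact ⟨s, t, hst⟩
  have exists_circuit (Z : Finset β) (hZF : Z ⊆ F) (hZ : Graph.IsCycleSet s t Z)
      (hodd : ∑ b ∈ Z, Graph.parity σ b = 1) :
      ∃ C, G.IsUnbalancedCircuit σ C ∧ E(C) ⊆ Z := by
    obtain ⟨Z₀, hsub, hmin, hsum⟩ := Graph.exists_isMinCycleSet hZ hodd
    have hst' : ∀ b ∈ Z₀, G.IsLink b (s b) (t b) := fun b hb ↦ hst b (hZF (hsub hb))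
    have hE : E(G.edgeSubgraph Z₀) = Z₀ :=
      Set.inter_eq_right.2 fun b hb ↦ (hst' b hb).edge_mem
    exact ⟨G.edgeSubgraph Z₀, ⟨G.edgeSubgraph_le _, hmin.isCircuit_edgeSubgraph hst',
      by rwa [hE, Graph.edgeSign_eq_neg_one_iff]⟩, by rw [hE]; exact_mod_cast hsub⟩
  have hcyc : Graph.IsCycleSet s t F := Graph.isCycleSet_of_even_valency hF.symm
    hG.isFinite.finite_vertexSet hst hG.even_valency
  have hsum : ∑ b ∈ F, Graph.parity σ b = 1 := by
    have : G.negativeEdges σ = ↑{b ∈ F | σ b = -1} := by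
      ext b; simp [Graph.negativeEdges, hmemF]
    rw [this, Set.ncard_coe_finset, ← ZMod.natCast_eq_one_iff_odd, ← Finset.sum_boole] at hodd
    exact hodd
  obtain ⟨e, he, x, hx⟩ := Graph.IsOddIntersecting.exists_isSignature_singleton
    (F := F) (s := s) (t := t) (σ := Graph.parity σ)
    ⟨hcyc, hsum, fun Z₁ hZ₁ Z₂ hZ₂ hc₁ hc₂ ho₁ ho₂ hd ↦ by
      obtain ⟨C₁, hC₁, hE₁⟩ := exists_circuit Z₁ hZ₁ hc₁ ho₁
      obtain ⟨C₂, hC₂, hE₂⟩ := exists_circuit Z₂ hZ₂ hc₂ ho₂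
      obtain ⟨b, hb₁, hb₂⟩ := hmeet C₁ C₂ hC₁ hC₂
      exact Finset.disjoint_left.1 hd (hE₁ hb₁) (hE₂ hb₂)⟩
  have hall (C : Graph α β) (hC : G.IsUnbalancedCircuit σ C) : e ∈ E(C) := by
    obtain ⟨Z, hZ⟩ := hC.isCircuit.isFinite.finite_edgeSet.exists_finset_coe
    have hZF : Z ⊆ F := fun b hb ↦ hmemF.2 (hC.le.edgeSet_mono (hZ ▸ hb))
    have hZc : Graph.IsCycleSet s t Z := Graph.isCycleSet_of_even_valency hZ.symm
      hC.isCircuit.isFinite.finite_vertexSet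
      (fun b hb ↦ (hC.le.isLink_iff (hZ ▸ hb)).2 (hst b (hZF hb)))
      fun v hv ↦ by rw [hC.isCircuit.valency_eq_two v hv]; exact even_two
    have hZs := hC.edgeSign_eq
    rw [← hZ, Graph.edgeSign_eq_neg_one_iff, Finset.sum_congr rfl fun b hb ↦ hx b (hZF hb),
      Finset.sum_add_distrib, hZc x, zero_add] at hZs
    by_contra hne
    rw [← hZ, Finset.mem_coe] at hne
    simp [hne] at hZs
  refine ⟨⟨e, hmemF.1 he, hall⟩, fun hbal ↦ ?_, e, hmemF.1 he, fun C hC ↦ ?_⟩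
  · obtain ⟨C, hC, -⟩ := exists_circuit F subset_rfl hcyc hsum
    exact hbal C hC
  · have hmem := hall C ⟨hC.le.trans Graph.deleteEdges_le, hC.isCircuit, hC.edgeSign_eq⟩
    simpa using hC.le.edgeSet_mono hmem
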